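/- **Theorem (Upper bounds on the measure of Cartesian products of the Cantor set).** Let $\mathcal C\subset[0,1]$ be the ternary (middle-thirds) Cantor set and, for $d\ge 1$, let $\mathcal C^d\subset\mathbb R^d$ be its $d$-fold Cartesian product. Put $s_d:=d\log_3 2$, and let $$\mathcal H^{s}(F)=\lim_{\delta\to0}\inf\Bigl\{\sum_{i=1}^\infty|U_i|^{s}: F\subset\bigcup_{i=1}^\infty U_i,\ |U_i|\le\delta\text{ for all } i\Bigr\}$$ be the (unnormalised) $s$-dimensional Hausdorff measure on $\mathbb R^d$, where $|U|$ is the Euclidean diameter of $U$. Then $$\begin{aligned} \mathcal H^{s_2}(\mathcal C^2)&\le 1.500886049123709,\\ \mathcal H^{s_3}(\mathcal C^3)&\le 2.352741546983966,\\ \mathcal H^{s_4}(\mathcal C^4)&\le 4.089697707421688,\\ \mathcal H^{s_5}(\mathcal C^5)&\le 7.502183963990683,\\ \mathcal H^{s_6}(\mathcal C^6)&\le 14.810000552236708,\\ \mathcal H^{s_7}(\mathcal C^7)&\le 31.501011683100224,\\ \mathcal H^{s_8}(\mathcal C^8)&\le 67.52795132236503. \end{aligned}$$ -/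

import Mathlib

open MeasureTheory

/-- The `d`-fold Cartesian product of the ternary Cantor set, as a subset of Euclidean `d`-space.
Here `cantorSet` is Mathlib's `⋂ n, C n` with `C 0 = [0,1]` and
`C (n+1) = (C n) / 3 ∪ (2 + C n) / 3`. -/
def cantorPower (d : ℕ) : Set (EuclideanSpace ℝ (Fin d)) :=
  {x | ∀ i, x i ∈ cantorSet}

/-- The `d * log_3 2`-dimensional Hausdorff measure of the `d`-fold product of the Cantor set.
Diameters are Euclidean, and Mathlib's `μH[s]` carries no normalising constant: it is
`lim_{δ → 0} inf {∑ |U_i|^s : |U_i| ≤ δ, F ⊆ ⋃ U_i}`. -/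
noncomputable def cantorPowerMeasure (d : ℕ) : ENNReal :=
  μH[(d : ℝ) * Real.logb 3 2] (cantorPower d)

/-!
A cube of side `3⁻ᵏ` of the `k`-th stage carries the fraction `2⁻ᵏᵈ` of the self-similar
probability measure `ν` on `𝒞ᵈ`, and `ℋˢ(𝒞ᵈ) ≤ |U| ^ s / ν(U)` for every set `U`: cover `𝒞ᵈ` by `U`
itself and by scaled copies of a near-optimal cover inside the cubes that `U` does not contain. As a
cover can be replaced by scaled copies of itself in the cubes of a high stage, the restriction on
the diameters in the definition of `ℋˢ` can be dropped. The bounds arise from balls `U` about the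
centre of the unit cube, with `ν(U)` bounded below by counting the cubes that `U` contains. In units
of `3⁻ᵏ / 2` and relative to the centre of the unit cube, the centres and corners of the cubes are
integral, so the count is exact arithmetic.
-/

open scoped ENNReal NNReal Finset

section HausdorffContent

variable {X Y : Type*} [EMetricSpace X] [EMetricSpace Y] {s : ℝ} {r r' : ℝ≥0∞} {A : Set X}

/-- The `s`-dimensional Hausdorff content at scale `r`: the infimum of `∑ |U_i| ^ s` over countable
covers by sets of diameter at most `r`. At `r = ∞` there is no restriction on the covers. -/
noncomputable def hausdorffContent (s : ℝ) (r : ℝ≥0∞) : OuterMeasure X :=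
  OuterMeasure.mkMetric'.pre (fun A ↦ Metric.ediam A ^ s) r

lemma hausdorffContent_le_ediam_rpow (h : Metric.ediam A ≤ r) :
    hausdorffContent s r A ≤ Metric.ediam A ^ s :=
  OuterMeasure.mkMetric'.pre_le h

lemma hausdorffContent_anti (h : r ≤ r') (A : Set X) :
    hausdorffContent s r' A ≤ hausdorffContent s r A :=
  OuterMeasure.mkMetric'.mono_pre _ h A

lemma hausdorffContent_top_ne_top (hs : 0 ≤ s) (hA : Metric.ediam A ≠ ∞) :
    hausdorffContent s ∞ A ≠ ∞ :=
  ne_top_of_le_ne_top (ENNReal.rpow_ne_top_of_nonneg hs hA) (hausdorffContent_le_ediam_rpow le_top)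

lemma hausdorffContent_le_top_of_ediam_le (hs : 0 ≤ s) (hA : Metric.ediam A ≤ r) :
    hausdorffContent s r A ≤ hausdorffContent s ∞ A := by
  have restrict_le : OuterMeasure.restrict A (hausdorffContent s r) ≤ hausdorffContent s ∞ := by
    refine OuterMeasure.mkMetric'.le_pre.2 fun B _ ↦ ?_
    rw [OuterMeasure.restrict_apply]
    calc hausdorffContent s r (B ∩ A)
        ≤ Metric.ediam (B ∩ A) ^ s :=
          hausdorffContent_le_ediam_rpow ((Metric.ediam_mono Set.inter_subset_right).trans hA)
      _ ≤ Metric.ediam B ^ s :=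
          ENNReal.rpow_le_rpow (Metric.ediam_mono Set.inter_subset_left) hs
  simpa using restrict_le A

lemma hausdorffContent_image_le (hs : 0 ≤ s) {K : ℝ≥0} (hK : K ≠ 0) {f : X → Y}
    (hf : LipschitzWith K f) (r : ℝ≥0∞) (A : Set X) :
    hausdorffContent s (K * r) (f '' A) ≤ (K : ℝ≥0∞) ^ s * hausdorffContent s r A := by
  have h0 : (K : ℝ≥0∞) ^ s ≠ 0 := by simp [ENNReal.rpow_eq_zero_iff, hK]
  have h1 : (K : ℝ≥0∞) ^ s ≠ ∞ := ENNReal.rpow_ne_top_of_nonneg hs ENNReal.coe_ne_top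
  have comap_le : ((K : ℝ≥0∞) ^ s)⁻¹ • OuterMeasure.comap f (hausdorffContent s (K * r)) ≤
      hausdorffContent s r := by
    refine OuterMeasure.mkMetric'.le_pre.2 fun B hB ↦ ?_
    rw [smul_apply, OuterMeasure.comap_apply, smul_eq_mul, ENNReal.inv_mul_le_iff h0 h1,
      ← ENNReal.mul_rpow_of_nonneg _ _ hs]
    have hfB := hf.ediam_image_le B
    exact (hausdorffContent_le_ediam_rpow (hfB.trans (by gcongr))).trans
      (ENNReal.rpow_le_rpow hfB hs)
  have := comap_le A
  rwa [smul_apply, OuterMeasure.comap_apply, smul_eq_mul, ENNReal.inv_mul_le_iff h0 h1] at this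

lemma hausdorffMeasure_le_of_forall_hausdorffContent_le [MeasurableSpace X] [BorelSpace X]
    {c : ℝ≥0∞} (h : ∀ r > 0, hausdorffContent s r A ≤ c) : μH[s] A ≤ c := by
  rw [Measure.hausdorffMeasure, ← Measure.coe_toOuterMeasure, Measure.mkMetric_toOuterMeasure,
    OuterMeasure.mkMetric, OuterMeasure.mkMetric']
  simp only [OuterMeasure.iSup_apply]
  exact iSup₂_le h

end HausdorffContent

section SubSelfSimilar

variable {X ι : Type*} [EMetricSpace X] {s : ℝ} {I : Finset ι} {f : ι → X → X} {K : ι → ℝ≥0}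
  {F : Set X}

/-- `F` is covered by its images under finitely many Lipschitz maps whose Lipschitz constants
satisfy `∑ K i ^ s ≤ 1`. The images may overlap and need not lie in `F`. -/
structure IsSubSelfSimilar (s : ℝ) (I : Finset ι) (f : ι → X → X) (K : ι → ℝ≥0) (F : Set X) :
    Prop where
  lipschitzWith : ∀ i ∈ I, LipschitzWith (K i) (f i)
  ne_zero : ∀ i ∈ I, K i ≠ 0
  sum_rpow_le_one : ∑ i ∈ I, (K i : ℝ≥0∞) ^ s ≤ 1
  subset_iUnion_image : F ⊆ ⋃ i ∈ I, f i '' F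

namespace IsSubSelfSimilar

lemma hausdorffContent_mul_le (hF : IsSubSelfSimilar s I f K F) (hs : 0 ≤ s) {κ : ℝ≥0}
    (hκ : ∀ i ∈ I, K i ≤ κ) (r : ℝ≥0∞) :
    hausdorffContent s (κ * r) F ≤ hausdorffContent s r F := by
  calc hausdorffContent s (κ * r) F
      ≤ ∑ i ∈ I, hausdorffContent s (κ * r) (f i '' F) :=
        (measure_mono hF.subset_iUnion_image).trans (measure_biUnion_finset_le _ _)
    _ ≤ ∑ i ∈ I, (K i : ℝ≥0∞) ^ s * hausdorffContent s r F := by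
        refine Finset.sum_le_sum fun i hi ↦ ?_
        exact (hausdorffContent_anti (by gcongr; exact hκ i hi) _).trans
          (hausdorffContent_image_le hs (hF.ne_zero i hi) (hF.lipschitzWith i hi) r F)
    _ ≤ hausdorffContent s r F := by
        rw [← Finset.sum_mul]
        exact mul_le_of_le_one_left' hF.sum_rpow_le_one

lemma hausdorffContent_pow_mul_le (hF : IsSubSelfSimilar s I f K F) (hs : 0 ≤ s) {κ : ℝ≥0}
    (hκ : ∀ i ∈ I, K i ≤ κ) (n : ℕ) (r : ℝ≥0∞) :
    hausdorffContent s (κ ^ n * r) F ≤ hausdorffContent s r F := by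
  induction n with
  | zero => simp
  | succ n ih =>
    rw [pow_succ', mul_assoc]
    exact (hF.hausdorffContent_mul_le hs hκ _).trans ih

theorem hausdorffMeasure_le_hausdorffContent [MeasurableSpace X] [BorelSpace X]
    (hF : IsSubSelfSimilar s I f K F) (hs : 0 ≤ s) (hK : ∀ i ∈ I, K i < 1)
    (hdiam : Metric.ediam F ≠ ∞) : μH[s] F ≤ hausdorffContent s ∞ F := by
  refine hausdorffMeasure_le_of_forall_hausdorffContent_le fun r hr ↦ ?_
  set κ := I.sup K
  have hκ : κ < 1 := (Finset.sup_lt_iff zero_lt_one).2 hK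
  obtain ⟨n, hn⟩ : ∃ n : ℕ, (κ : ℝ≥0∞) ^ n * Metric.ediam F < r := by
    have := ENNReal.Tendsto.mul_const (ENNReal.tendsto_pow_atTop_nhds_zero_of_lt_one
      (ENNReal.coe_lt_one_iff.2 hκ)) (Or.inr hdiam)
    rw [zero_mul] at this
    exact (this.eventually_lt_const hr).exists
  calc hausdorffContent s r F
      ≤ hausdorffContent s (κ ^ n * Metric.ediam F) F :=
        hausdorffContent_anti hn.le F
    _ ≤ hausdorffContent s (Metric.ediam F) F :=
        hF.hausdorffContent_pow_mul_le hs (fun _ hi ↦ Finset.le_sup hi) n _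
    _ ≤ hausdorffContent s ∞ F := hausdorffContent_le_top_of_ediam_le hs le_rfl

theorem hausdorffContent_mul_sum_rpow_le (hF : IsSubSelfSimilar s I f K F) (hs : 0 ≤ s)
    (hdiam : Metric.ediam F ≠ ∞) {G : Finset ι} (hG : G ⊆ I) {U : Set X}
    (hU : ∀ i ∈ G, f i '' F ⊆ U) :
    hausdorffContent s ∞ F * ∑ i ∈ G, (K i : ℝ≥0∞) ^ s ≤ Metric.ediam U ^ s := by
  classical
  set c := hausdorffContent s ∞ F
  set rest := ∑ i ∈ I \ G, (K i : ℝ≥0∞) ^ s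
  have hsplit : rest + ∑ i ∈ G, (K i : ℝ≥0∞) ^ s ≤ 1 :=
    (Finset.sum_sdiff hG).trans_le hF.sum_rpow_le_one
  have hcover : F ⊆ U ∪ ⋃ i ∈ I \ G, f i '' F := by
    intro x hx
    obtain ⟨i, hi, hxi⟩ := Set.mem_iUnion₂.1 (hF.subset_iUnion_image hx)
    by_cases hiG : i ∈ G
    · exact Or.inl (hU i hiG hxi)
    · exact Or.inr (Set.mem_iUnion₂.2 ⟨i, Finset.mem_sdiff.2 ⟨hi, hiG⟩, hxi⟩)
  have himage : ∀ i ∈ I \ G, hausdorffContent s ∞ (f i '' F) ≤ (K i : ℝ≥0∞) ^ s * c := by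
    intro i hi
    have hiI := (Finset.mem_sdiff.1 hi).1
    simpa [ENNReal.mul_top, hF.ne_zero i hiI] using
      hausdorffContent_image_le hs (hF.ne_zero i hiI) (hF.lipschitzWith i hiI) ∞ F
  have hc : c ≤ Metric.ediam U ^ s + rest * c := by
    refine (measure_mono hcover).trans <| (measure_union_le _ _).trans ?_
    gcongr
    · exact hausdorffContent_le_ediam_rpow le_top
    · rw [Finset.sum_mul]
      exact (measure_biUnion_finset_le _ _).trans (Finset.sum_le_sum himage)
  have hrest : rest * c ≠ ∞ :=
    ENNReal.mul_ne_top (ne_top_of_le_ne_top ENNReal.one_ne_top (le_self_add.trans hsplit))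
      (hausdorffContent_top_ne_top hs hdiam)
  refine ENNReal.le_of_add_le_add_right hrest ?_
  calc c * ∑ i ∈ G, (K i : ℝ≥0∞) ^ s + rest * c
      = (rest + ∑ i ∈ G, (K i : ℝ≥0∞) ^ s) * c := by ring
    _ ≤ c := mul_le_of_le_one_left' hsplit
    _ ≤ Metric.ediam U ^ s + rest * c := hc

end IsSubSelfSimilar

end SubSelfSimilar

section CantorCenters

/-- The integers `m` such that the interval of length `3⁻ᵏ` about `(1 + m / 3ᵏ) / 2` is one of the
`2ᵏ` intervals of the `k`-th stage of the construction of the Cantor set. -/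
def cantorCenters : ℕ → Finset ℤ
  | 0 => {0}
  | k + 1 => (cantorCenters k).image (· - 2 * 3 ^ k) ∪ (cantorCenters k).image (· + 2 * 3 ^ k)

lemma abs_lt_of_mem_cantorCenters {k : ℕ} {m : ℤ} (h : m ∈ cantorCenters k) : |m| < 3 ^ k := by
  induction k generalizing m with
  | zero => simp_all [cantorCenters]
  | succ k ih =>
    simp only [cantorCenters, Finset.mem_union, Finset.mem_image] at h
    rw [pow_succ, abs_lt]
    obtain ⟨n, hn, rfl⟩ | ⟨n, hn, rfl⟩ := h <;> have := abs_lt.1 (ih hn) <;> omega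

lemma sum_cantorCenters_succ {M : Type*} [AddCommMonoid M] (k : ℕ) (f : ℤ → M) :
    ∑ m ∈ cantorCenters (k + 1), f m =
      ∑ m ∈ cantorCenters k, f (m - 2 * 3 ^ k) + ∑ m ∈ cantorCenters k, f (m + 2 * 3 ^ k) := by
  have hdisj : Disjoint ((cantorCenters k).image (· - 2 * 3 ^ k))
      ((cantorCenters k).image (· + 2 * 3 ^ k)) := by
    simp only [Finset.disjoint_left, Finset.mem_image]
    rintro _ ⟨m, hm, rfl⟩ ⟨n, hn, hmn⟩
    have := abs_lt.1 (abs_lt_of_mem_cantorCenters hm)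
    have := abs_lt.1 (abs_lt_of_mem_cantorCenters hn)
    omega
  rw [cantorCenters, Finset.sum_union hdisj, Finset.sum_image (by simp), Finset.sum_image (by simp)]

lemma card_cantorCenters (k : ℕ) : #(cantorCenters k) = 2 ^ k := by
  induction k with
  | zero => rfl
  | succ k ih => rw [Finset.card_eq_sum_ones, sum_cantorCenters_succ, ← Finset.card_eq_sum_ones, ih,
      pow_succ, mul_two]

lemma exists_mem_cantorCenters {x : ℝ} (hx : x ∈ cantorSet) (k : ℕ) :
    ∃ m ∈ cantorCenters k, ∃ y ∈ cantorSet, x = 1 / 2 + (3 ^ k)⁻¹ * (y - 1 / 2 + m / 2) := by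
  induction k generalizing x with
  | zero => exact ⟨0, by simp [cantorCenters], x, hx, by simp⟩
  | succ k ih =>
    rw [cantorSet_eq_union_halves] at hx
    obtain ⟨z, hz, rfl⟩ | ⟨z, hz, rfl⟩ := hx <;> obtain ⟨m, hm, y, hy, rfl⟩ := ih hz
    · refine ⟨m - 2 * 3 ^ k, by simp [cantorCenters, hm], y, hy, ?_⟩
      push_cast
      field
    · refine ⟨m + 2 * 3 ^ k, by simp [cantorCenters, hm], y, hy, ?_⟩
      push_cast
      field

end CantorCenters

section CantorCubes

variable {d : ℕ} {k : ℕ}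

/-- The index set of the `2ᵏᵈ` cubes of the `k`-th stage of the construction of `cantorPower d`. -/
def cantorCubes (d k : ℕ) : Finset (Fin d → ℤ) :=
  Fintype.piFinset fun _ ↦ cantorCenters k

lemma card_cantorCubes (d k : ℕ) : #(cantorCubes d k) = 2 ^ (k * d) := by
  simp [cantorCubes, card_cantorCenters, pow_mul]

/-- The centre of the unit cube. -/
noncomputable def cubeCenter (d : ℕ) : EuclideanSpace ℝ (Fin d) :=
  WithLp.toLp 2 fun _ ↦ 1 / 2

/-- The similarity of ratio `3⁻ᵏ` that maps the unit cube onto the `k`-th stage cube of index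
`c`. -/
noncomputable def cubeMap (k : ℕ) (c : Fin d → ℤ) (x : EuclideanSpace ℝ (Fin d)) :
    EuclideanSpace ℝ (Fin d) :=
  cubeCenter d + ((3 : ℝ) ^ k)⁻¹ • (x - cubeCenter d + WithLp.toLp 2 fun i ↦ (c i / 2 : ℝ))

lemma lipschitzWith_cubeMap (k : ℕ) (c : Fin d → ℤ) :
    LipschitzWith ((3 : ℝ≥0) ^ k)⁻¹ (cubeMap k c) :=
  LipschitzWith.of_dist_le_mul fun x y ↦ by simp [cubeMap, dist_smul₀]

lemma cantorPower_subset_iUnion_cubeMap (d k : ℕ) :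
    cantorPower d ⊆ ⋃ c ∈ cantorCubes d k, cubeMap k c '' cantorPower d := by
  intro x hx
  choose c hc y hy hxy using fun i ↦ exists_mem_cantorCenters (hx i) k
  refine Set.mem_iUnion₂.2 ⟨c, by simpa [cantorCubes] using hc, WithLp.toLp 2 y, hy, ?_⟩
  ext i
  simp [cubeMap, cubeCenter, hxy i, mul_add]

lemma ediam_cantorPower_ne_top (d : ℕ) : Metric.ediam (cantorPower d) ≠ ∞ := by
  have hpi : Bornology.IsBounded (Set.univ.pi fun _ : Fin d ↦ cantorSet) :=
    (isCompact_univ_pi fun _ ↦ isCompact_cantorSet).isBounded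
  have himage := (PiLp.lipschitzWith_toLp 2 (fun _ : Fin d ↦ ℝ)).isBounded_image hpi
  exact Metric.isBounded_iff_ediam_ne_top.1 <|
    himage.subset fun x hx ↦ ⟨x.ofLp, fun i _ ↦ hx i, rfl⟩

/-- The similarity dimension `d log₃ 2` of `cantorPower d`. -/
noncomputable def cantorDim (d : ℕ) : ℝ := d * Real.logb 3 2

lemma cantorDim_nonneg (d : ℕ) : 0 ≤ cantorDim d :=
  mul_nonneg d.cast_nonneg (Real.logb_nonneg (by norm_num) (by norm_num))

lemma three_rpow_cantorDim (d : ℕ) : (3 : ℝ) ^ cantorDim d = 2 ^ d := by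
  rw [cantorDim, mul_comm, Real.rpow_mul (by norm_num),
    Real.rpow_logb (by norm_num) (by norm_num) (by norm_num), Real.rpow_natCast]

lemma inv_three_pow_rpow_cantorDim (d k : ℕ) :
    ((((3 : ℝ≥0) ^ k)⁻¹ : ℝ≥0) : ℝ≥0∞) ^ cantorDim d = (2 ^ (k * d))⁻¹ := by
  have h3 : (3 : ℝ≥0∞) ^ cantorDim d = 2 ^ d := by
    rw [← ENNReal.ofReal_ofNat 3, ENNReal.ofReal_rpow_of_pos (by norm_num), three_rpow_cantorDim,
      ENNReal.ofReal_pow (by norm_num), ENNReal.ofReal_ofNat]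
  rw [ENNReal.coe_inv (by positivity), ENNReal.inv_rpow, ENNReal.coe_pow, ENNReal.coe_ofNat,
    ← ENNReal.rpow_natCast, ← ENNReal.rpow_mul, mul_comm (k : ℝ), ENNReal.rpow_mul, h3,
    ENNReal.rpow_natCast, ← pow_mul, mul_comm d]

lemma isSubSelfSimilar_cantorPower (d k : ℕ) :
    IsSubSelfSimilar (cantorDim d) (cantorCubes d k) (cubeMap k) (fun _ ↦ ((3 : ℝ≥0) ^ k)⁻¹)
      (cantorPower d) where
  lipschitzWith c _ := lipschitzWith_cubeMap k c
  ne_zero _ _ := by positivity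
  sum_rpow_le_one := by
    rw [Finset.sum_const, inv_three_pow_rpow_cantorDim, card_cantorCubes, nsmul_eq_mul]
    push_cast
    exact ENNReal.mul_inv_le_one _
  subset_iUnion_image := cantorPower_subset_iUnion_cubeMap d k

theorem cantorPowerMeasure_mul_card_le {G : Finset (Fin d → ℤ)} (hG : G ⊆ cantorCubes d k)
    {U : Set (EuclideanSpace ℝ (Fin d))} (hU : ∀ c ∈ G, cubeMap k c '' cantorPower d ⊆ U) :
    cantorPowerMeasure d * #G ≤ Metric.ediam U ^ cantorDim d * 2 ^ (k * d) := by
  have hcontent : cantorPowerMeasure d ≤ hausdorffContent (cantorDim d) ∞ (cantorPower d) :=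
    (isSubSelfSimilar_cantorPower d 1).hausdorffMeasure_le_hausdorffContent (cantorDim_nonneg d)
      (fun _ _ ↦ inv_lt_one_of_one_lt₀ (by norm_num)) (ediam_cantorPower_ne_top d)
  have hdensity := (isSubSelfSimilar_cantorPower d k).hausdorffContent_mul_sum_rpow_le
    (cantorDim_nonneg d) (ediam_cantorPower_ne_top d) hG hU
  rw [Finset.sum_const, inv_three_pow_rpow_cantorDim, nsmul_eq_mul, ← mul_assoc, ← div_eq_mul_inv,
    ENNReal.div_le_iff (by positivity) (by finiteness)] at hdensity
  exact (mul_le_mul_left hcontent _).trans hdensity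

end CantorCubes

section Balls

variable {d k D : ℕ}

/-- The indices of the cubes of the `k`-th stage inside the ball of diameter `√D / 3ᵏ` about the
centre of the unit cube: in units of `3⁻ᵏ / 2`, the corner of the cube of index `c` farthest from
the centre has distance `|c i| + 1` from it in the `i`-th coordinate. -/
def cubesInBall (d k D : ℕ) : Finset (Fin d → ℤ) :=
  {c ∈ cantorCubes d k | ∑ i, ((c i).natAbs + 1) ^ 2 ≤ D}

lemma sq_sub_half_add_half_le {x : ℝ} (hx : x ∈ Set.Icc 0 1) (m : ℤ) :
    (x - 1 / 2 + m / 2) ^ 2 ≤ ((m.natAbs + 1) / 2) ^ 2 := by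
  obtain ⟨hx0, hx1⟩ := hx
  rw [Nat.cast_natAbs, Int.cast_abs]
  refine sq_le_sq' ?_ ?_
  · linarith [neg_abs_le (m : ℝ)]
  · linarith [le_abs_self (m : ℝ)]

lemma cubeMap_image_subset_closedBall {c : Fin d → ℤ} (hc : c ∈ cubesInBall d k D) :
    cubeMap k c '' cantorPower d ⊆ Metric.closedBall (cubeCenter d) (√D / 3 ^ k / 2) := by
  rintro _ ⟨x, hx, rfl⟩
  have hsum : ∑ i, (x i - 1 / 2 + c i / 2 : ℝ) ^ 2 ≤ D / 2 ^ 2 := by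
    calc ∑ i, (x i - 1 / 2 + c i / 2 : ℝ) ^ 2
        ≤ ∑ i, (((c i).natAbs + 1) / 2 : ℝ) ^ 2 :=
          Finset.sum_le_sum fun i _ ↦
            sq_sub_half_add_half_le (cantorSet_subset_unitInterval (hx i)) (c i)
      _ = (∑ i, ((c i).natAbs + 1) ^ 2 : ℕ) / 2 ^ 2 := by
          push_cast
          simp only [div_pow, Finset.sum_div]
      _ ≤ D / 2 ^ 2 := by
          gcongr
          exact (Finset.mem_filter.1 hc).2
  have hnorm : ‖x - cubeCenter d + WithLp.toLp 2 fun i ↦ (c i / 2 : ℝ)‖ ≤ √D / 2 := by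
    rw [EuclideanSpace.norm_eq]
    refine Real.sqrt_le_iff.2 ⟨by positivity, ?_⟩
    simpa [cubeCenter, div_pow] using hsum
  rw [Metric.mem_closedBall, cubeMap, dist_self_add_left, norm_smul, norm_inv, norm_pow,
    Real.norm_ofNat, div_right_comm, inv_mul_eq_div]
  gcongr

theorem cantorPowerMeasure_mul_card_cubesInBall_le (d k D : ℕ) :
    cantorPowerMeasure d * #(cubesInBall d k D) ≤
      ENNReal.ofReal ((√D / 3 ^ k) ^ cantorDim d * 2 ^ (k * d)) := by
  set t := √D / 3 ^ k
  have hdiam : Metric.ediam (Metric.closedBall (cubeCenter d) (t / 2)) ≤ ENNReal.ofReal t := by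
    rw [← Metric.closedEBall_ofReal (by positivity)]
    refine Metric.ediam_closedEBall_le.trans_eq ?_
    rw [← ENNReal.ofReal_ofNat 2, ← ENNReal.ofReal_mul zero_le_two, mul_div_cancel₀ _ two_ne_zero]
  calc cantorPowerMeasure d * #(cubesInBall d k D)
      ≤ Metric.ediam (Metric.closedBall (cubeCenter d) (t / 2)) ^ cantorDim d * 2 ^ (k * d) :=
        cantorPowerMeasure_mul_card_le (Finset.filter_subset _ _)
          fun _ hc ↦ cubeMap_image_subset_closedBall hc
    _ ≤ ENNReal.ofReal t ^ cantorDim d * 2 ^ (k * d) := by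
        gcongr
        exact cantorDim_nonneg d
    _ = ENNReal.ofReal (t ^ cantorDim d * 2 ^ (k * d)) := by
        rw [ENNReal.ofReal_rpow_of_nonneg (by positivity) (cantorDim_nonneg d),
          ENNReal.ofReal_mul (by positivity), ENNReal.ofReal_pow zero_le_two, ENNReal.ofReal_ofNat]

end Balls

section RationalBounds

lemma logb_le_div_of_pow_le_pow {b x : ℝ} (hb : 1 < b) (hx : 0 < x) {p q : ℕ} (hq : 0 < q)
    (h : x ^ q ≤ b ^ p) : Real.logb b x ≤ p / q := by
  rw [le_div_iff₀' (by positivity), ← Real.logb_pow]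
  exact (Real.logb_le_iff_le_rpow hb (by positivity)).2 (by rwa [Real.rpow_natCast])

-- `665 / 1054` is the convergent of `log₃ 2` from above with relative error below `10⁻⁷`.
lemma cantorDim_le (d : ℕ) : cantorDim d ≤ (665 * d : ℕ) / 1054 := by
  have hlogb := logb_le_div_of_pow_le_pow (b := 3) (x := 2) (by norm_num) (by norm_num)
    (p := 665) (q := 1054) (by norm_num)
    (by exact_mod_cast (by decide +kernel : 2 ^ 1054 ≤ 3 ^ 665))
  calc cantorDim d ≤ d * ((665 : ℕ) / (1054 : ℕ)) := by unfold cantorDim; gcongr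
    _ = (665 * d : ℕ) / 1054 := by push_cast; ring

lemma sqrt_rpow_cantorDim_pow_le {x : ℝ} (hx : 1 ≤ x) (d : ℕ) :
    (√x ^ cantorDim d) ^ 2108 ≤ x ^ (665 * d) := by
  have hx0 : 0 ≤ x := zero_le_one.trans hx
  calc (√x ^ cantorDim d) ^ 2108
      ≤ (√x ^ ((665 * d : ℕ) / 1054 : ℝ)) ^ 2108 := by
        gcongr
        · exact Real.one_le_sqrt.2 hx
        · exact cantorDim_le d
    _ = √x ^ (2 * (665 * d)) := by
        rw [← Real.rpow_mul_natCast (Real.sqrt_nonneg x), ← Real.rpow_natCast]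
        push_cast
        ring_nf
    _ = x ^ (665 * d) := by rw [pow_mul, Real.sq_sqrt hx0]

theorem cantorPowerMeasure_le_ofReal_div {d k D N num den : ℕ} (hden : 0 < den) (hD : 9 ^ k ≤ D)
    (hN : N ≤ #(cubesInBall d k D))
    (h : D ^ (665 * d) * (2 ^ (k * d) * den) ^ 2108 ≤ (9 ^ k) ^ (665 * d) * (num * N) ^ 2108) :
    cantorPowerMeasure d ≤ ENNReal.ofReal (num / den) := by
  have hD0 : 0 < D := (by positivity : 0 < 9 ^ k).trans_le hD
  have hN0 : N ≠ 0 := by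
    rintro rfl
    have : 0 < D ^ (665 * d) * (2 ^ (k * d) * den) ^ 2108 := by positivity
    simp [this.ne'] at h
  have hsqrt : √D / 3 ^ k = √(D / 9 ^ k) := by
    rw [Real.sqrt_div' _ (by positivity), show (9 : ℝ) ^ k = (3 ^ k) ^ 2 by
      rw [← pow_mul, mul_comm, pow_mul]; norm_num, Real.sqrt_sq (by positivity)]
  have hpow : (√(D / 9 ^ k) ^ cantorDim d * 2 ^ (k * d) : ℝ) ≤ num / den * N := by
    rw [← pow_le_pow_iff_left₀ (by positivity) (by positivity) (show 2108 ≠ 0 by norm_num), mul_pow]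
    have hx : 1 ≤ (D / 9 ^ k : ℝ) := (one_le_div (by positivity)).2 (by exact_mod_cast hD)
    refine (mul_le_mul_of_nonneg_right (sqrt_rpow_cantorDim_pow_le hx d) (by positivity)).trans ?_
    rw [div_mul_eq_mul_div, div_pow, div_pow, div_mul_eq_mul_div,
      div_le_div_iff₀ (by positivity) (by positivity), mul_assoc, ← mul_pow, mul_comm (_ ^ 2108)]
    exact_mod_cast h
  rw [← ENNReal.mul_le_mul_iff_left (Nat.cast_ne_zero.2 hN0) (ENNReal.natCast_ne_top N)]
  calc cantorPowerMeasure d * N ≤ cantorPowerMeasure d * #(cubesInBall d k D) := by gcongr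
    _ ≤ ENNReal.ofReal ((√D / 3 ^ k) ^ cantorDim d * 2 ^ (k * d)) :=
        cantorPowerMeasure_mul_card_cubesInBall_le d k D
    _ ≤ ENNReal.ofReal (num / den * N) := ENNReal.ofReal_le_ofReal (hsqrt ▸ hpow)
    _ = ENNReal.ofReal (num / den) * N := by
        rw [ENNReal.ofReal_mul (by positivity), ENNReal.ofReal_natCast]

end RationalBounds

section GeneratingFunction

-- In base `B`, reduction mod `B ^ (T + 1)` drops the terms of weight above `T`, and reduction mod
-- `B - 1` takes the digit sum.
lemma card_filter_le_eq_sum_pow_mod {α : Type*} (P : Finset α) (w : α → ℕ) {B : ℕ}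
    (hB : #P + 1 < B) (T : ℕ) :
    #{c ∈ P | w c ≤ T} = (∑ c ∈ P, B ^ w c) % B ^ (T + 1) % (B - 1) := by
  set A := {c ∈ P | w c ≤ T}
  have hcard : #A ≤ #P := Finset.card_filter_le _ _
  have hB0 : 0 < B := by omega
  have hlow : ∑ c ∈ A, B ^ w c < B ^ (T + 1) := by
    calc ∑ c ∈ A, B ^ w c ≤ #A • B ^ T :=
          Finset.sum_le_card_nsmul _ _ _ fun c hc ↦
            Nat.pow_le_pow_right (by omega) (Finset.mem_filter.1 hc).2
      _ < B * B ^ T := by rw [smul_eq_mul]; gcongr; omega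
      _ = B ^ (T + 1) := (pow_succ' B T).symm
  have hhigh : B ^ (T + 1) ∣ ∑ c ∈ P with ¬ w c ≤ T, B ^ w c :=
    Finset.dvd_sum fun c hc ↦ pow_dvd_pow B (not_le.1 (Finset.mem_filter.1 hc).2)
  have hdigits : ∑ c ∈ A, B ^ w c ≡ #A [MOD B - 1] := by
    have hB1 : B ≡ 1 [MOD B - 1] := ((Nat.modEq_iff_dvd' (by omega)).2 dvd_rfl).symm
    rw [Finset.card_eq_sum_ones]
    exact Nat.ModEq.sum fun c _ ↦ by simpa using hB1.pow (w c)
  obtain ⟨n, hn⟩ := hhigh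
  rw [← Finset.sum_filter_add_sum_filter_not P (w · ≤ T), hn, Nat.add_mul_mod_self_left,
    Nat.mod_eq_of_lt hlow, hdigits, Nat.mod_eq_of_lt (by omega)]

lemma sum_piFinset_pow_sum {α R : Type*} [CommSemiring R] (S : Finset α) (g : α → ℕ) (x : R)
    (d : ℕ) :
    ∑ c ∈ Fintype.piFinset fun _ : Fin d ↦ S, x ^ ∑ i, g (c i) = (∑ a ∈ S, x ^ g a) ^ d := by
  simp only [Finset.sum_pow', Finset.prod_pow_eq_pow_sum]

/-- The sum of `f (m + c)` over `c ∈ cantorCenters k`, in a form that the kernel evaluates fast. -/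
def centerSum (f : ℤ → ℕ) : ℕ → ℤ → ℕ
  | 0, m => f m
  | k + 1, m => centerSum f k (m - 2 * 3 ^ k) + centerSum f k (m + 2 * 3 ^ k)

lemma centerSum_eq (f : ℤ → ℕ) (k : ℕ) (m : ℤ) :
    centerSum f k m = ∑ c ∈ cantorCenters k, f (m + c) := by
  induction k generalizing m with
  | zero => simp [centerSum, cantorCenters]
  | succ k ih =>
    simp only [centerSum, sum_cantorCenters_succ, ih]
    congr! 3 <;> ring

/-- The number of cubes of the `k`-th stage for which `∑ i, ⌊(|c i| + 1)² / q⌋ ≤ T`, read off from a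
generating function. Rounding to multiples of `q` keeps the integers short. -/
def ballCount (d k q T : ℕ) : ℕ :=
  centerSum (fun m ↦ (2 ^ (d * k + 1)) ^ ((m.natAbs + 1) ^ 2 / q)) k 0 ^ d %
    (2 ^ (d * k + 1)) ^ (T + 1) % (2 ^ (d * k + 1) - 1)

lemma ballCount_eq {d k : ℕ} (hdk : 1 < d * k) (q T : ℕ) :
    ballCount d k q T = #{c ∈ cantorCubes d k | ∑ i, ((c i).natAbs + 1) ^ 2 / q ≤ T} := by
  have hB : #(cantorCubes d k) + 1 < 2 ^ (d * k + 1) := by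
    have := Nat.pow_lt_pow_right (a := 2) (by norm_num) hdk
    rw [card_cantorCubes, mul_comm k, pow_succ]
    omega
  rw [card_filter_le_eq_sum_pow_mod _ _ hB, cantorCubes,
    sum_piFinset_pow_sum _ fun m : ℤ ↦ (m.natAbs + 1) ^ 2 / q]
  simp only [ballCount, centerSum_eq, zero_add]

lemma ballCount_le_card_cubesInBall {d k q : ℕ} (hdk : 1 < d * k) (hq : 0 < q) (T : ℕ) :
    ballCount d k q T ≤ #(cubesInBall d k (q * (T + d))) := by
  rw [ballCount_eq hdk]
  refine Finset.card_le_card (Finset.monotone_filter_right _ fun c _ hc ↦ ?_)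
  calc ∑ i, ((c i).natAbs + 1) ^ 2
      ≤ ∑ i, q * (((c i).natAbs + 1) ^ 2 / q + 1) :=
        Finset.sum_le_sum fun i _ ↦ (Nat.lt_mul_div_succ _ hq).le
    _ = q * (∑ i, ((c i).natAbs + 1) ^ 2 / q + d) := by
        simp [← Finset.mul_sum, Finset.sum_add_distrib]
    _ ≤ q * (T + d) := by gcongr

end GeneratingFunction

section Quadtree

/-- A lower bound for the number of squares of a stage that lie in the disc of diameter `√D` about
the origin, among the `4ʲ` ones that descend from a square with centre `(m, n) / 2` and side `3ʲ`,
the side of the squares of the stage being the unit of length. An ancestor inside the disc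
contributes all of its descendants, one outside the disc none. -/
def discCount (D : ℕ) : ℕ → ℤ → ℤ → ℕ
  | 0, m, n => if (m.natAbs + 1) ^ 2 + (n.natAbs + 1) ^ 2 ≤ D then 1 else 0
  | j + 1, m, n =>
    if (m.natAbs + 3 ^ (j + 1)) ^ 2 + (n.natAbs + 3 ^ (j + 1)) ^ 2 ≤ D then 4 ^ (j + 1)
    else if D < (m.natAbs - 3 ^ (j + 1)) ^ 2 + (n.natAbs - 3 ^ (j + 1)) ^ 2 then 0
    else
      (discCount D j (m - 2 * 3 ^ j) (n - 2 * 3 ^ j) +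
        discCount D j (m - 2 * 3 ^ j) (n + 2 * 3 ^ j)) +
      (discCount D j (m + 2 * 3 ^ j) (n - 2 * 3 ^ j) +
        discCount D j (m + 2 * 3 ^ j) (n + 2 * 3 ^ j))

lemma natAbs_add_one_le_of_mem_cantorCenters {j : ℕ} {u : ℤ} (hu : u ∈ cantorCenters j) (m : ℤ) :
    (m + u).natAbs + 1 ≤ m.natAbs + 3 ^ j := by
  have := abs_lt_of_mem_cantorCenters hu
  zify
  linarith [abs_add_le m u]

lemma discCount_le (D j : ℕ) (m n : ℤ) :
    discCount D j m n ≤ ∑ u ∈ cantorCenters j, ∑ v ∈ cantorCenters j,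
      if ((m + u).natAbs + 1) ^ 2 + ((n + v).natAbs + 1) ^ 2 ≤ D then 1 else 0 := by
  induction j generalizing m n with
  | zero => simp [discCount, cantorCenters, -Finset.sum_boole]
  | succ j ih =>
    rw [discCount]
    split_ifs with hinside
    · have hall : ∀ u ∈ cantorCenters (j + 1), ∀ v ∈ cantorCenters (j + 1),
          ((m + u).natAbs + 1) ^ 2 + ((n + v).natAbs + 1) ^ 2 ≤ D := fun u hu v hv ↦ by
        have := natAbs_add_one_le_of_mem_cantorCenters hu m
        have := natAbs_add_one_le_of_mem_cantorCenters hv n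
        exact le_trans (by gcongr) hinside
      rw [Finset.sum_congr rfl fun u hu ↦ Finset.sum_congr rfl fun v hv ↦ if_pos (hall u hu v hv)]
      simp only [Finset.sum_const, card_cantorCenters, smul_eq_mul, mul_one, ← mul_pow]
      norm_num
    · exact Nat.zero_le _
    · refine (add_le_add (add_le_add (ih _ _) (ih _ _)) (add_le_add (ih _ _) (ih _ _))).trans_eq ?_
      simp only [sum_cantorCenters_succ, Finset.sum_add_distrib, add_sub_assoc', sub_add_eq_add_sub,
        ← add_assoc, add_right_comm _ (2 * _ : ℤ)]
      abel

lemma discCount_le_card_cubesInBall (D k : ℕ) : discCount D k 0 0 ≤ #(cubesInBall 2 k D) := by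
  refine (discCount_le D k 0 0).trans ?_
  simp only [zero_add]
  rw [← Finset.sum_product', ← Finset.card_filter]
  refine Finset.card_le_card_of_injOn (fun p ↦ ![p.1, p.2]) ?_ ?_
  · rintro ⟨u, v⟩ h
    simpa [cubesInBall, cantorCubes, Fin.forall_fin_two] using h
  · rintro ⟨u, v⟩ _ ⟨u', v'⟩ _ h
    simpa using h

end Quadtree

lemma le_card_cubesInBall_two : 249350208 ≤ #(cubesInBall 2 14 38737618576730) :=
  (by decide +kernel : 249350208 ≤ discCount 38737618576730 14 0 0).trans
    (discCount_le_card_cubesInBall _ _)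

-- For `d ≥ 3`, the factor `T + d` in the squared radius minimises the resulting bound for the given
-- stage and rounding (a numerical search).
lemma le_card_cubesInBall_three : 940823248 ≤ #(cubesInBall 3 10 (249886 * (29964 + 3))) :=
  (by decide +kernel : 940823248 ≤ ballCount 3 10 249886 29964).trans
    (ballCount_le_card_cubesInBall (by norm_num) (by norm_num) _)

lemma le_card_cubesInBall_four : 3397530592 ≤ #(cubesInBall 4 8 (35872 * (3038 + 4))) :=
  (by decide +kernel : 3397530592 ≤ ballCount 4 8 35872 3038).trans
    (ballCount_le_card_cubesInBall (by norm_num) (by norm_num) _)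

lemma le_card_cubesInBall_five : 27250341952 ≤ #(cubesInBall 5 7 (14348 * (1027 + 5))) :=
  (by decide +kernel : 27250341952 ≤ ballCount 5 7 14348 1027).trans
    (ballCount_le_card_cubesInBall (by norm_num) (by norm_num) _)

lemma le_card_cubesInBall_six : 50536231936 ≤ #(cubesInBall 6 6 (1860 * (999 + 6))) :=
  (by decide +kernel : 50536231936 ≤ ballCount 6 6 1860 999).trans
    (ballCount_le_card_cubesInBall (by norm_num) (by norm_num) _)

lemma le_card_cubesInBall_seven : 24763422336 ≤ #(cubesInBall 7 5 (787 * (299 + 7))) :=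
  (by decide +kernel : 24763422336 ≤ ballCount 7 5 787 299).trans
    (ballCount_le_card_cubesInBall (by norm_num) (by norm_num) _)

lemma le_card_cubesInBall_eight : 760047842304 ≤ #(cubesInBall 8 5 (885 * (296 + 8))) :=
  (by decide +kernel : 760047842304 ≤ ballCount 8 5 885 296).trans
    (ballCount_le_card_cubesInBall (by norm_num) (by norm_num) _)

theorem mainTheorem2 :
    cantorPowerMeasure 2 ≤ ENNReal.ofReal 1.500886049123709 ∧
    cantorPowerMeasure 3 ≤ ENNReal.ofReal 2.352741546983966 ∧
    cantorPowerMeasure 4 ≤ ENNReal.ofReal 4.089697707421688 ∧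
    cantorPowerMeasure 5 ≤ ENNReal.ofReal 7.502183963990683 ∧
    cantorPowerMeasure 6 ≤ ENNReal.ofReal 14.810000552236708 ∧
    cantorPowerMeasure 7 ≤ ENNReal.ofReal 31.501011683100224 ∧
    cantorPowerMeasure 8 ≤ ENNReal.ofReal 67.52795132236503 := by
  refine ⟨?_, ?_, ?_, ?_, ?_, ?_, ?_⟩
  · exact (cantorPowerMeasure_le_ofReal_div (num := 1500886049123709) (den := 10 ^ 15)
      (by norm_num) (by norm_num) le_card_cubesInBall_two (by decide +kernel)).trans_eq
      (by norm_num)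
  · exact (cantorPowerMeasure_le_ofReal_div (num := 2352741546983966) (den := 10 ^ 15)
      (by norm_num) (by norm_num) le_card_cubesInBall_three (by decide +kernel)).trans_eq
      (by norm_num)
  · exact (cantorPowerMeasure_le_ofReal_div (num := 4089697707421688) (den := 10 ^ 15)
      (by norm_num) (by norm_num) le_card_cubesInBall_four (by decide +kernel)).trans_eq
      (by norm_num)
  · exact (cantorPowerMeasure_le_ofReal_div (num := 7502183963990683) (den := 10 ^ 15)
      (by norm_num) (by norm_num) le_card_cubesInBall_five (by decide +kernel)).trans_eq
      (by norm_num)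
  · exact (cantorPowerMeasure_le_ofReal_div (num := 14810000552236708) (den := 10 ^ 15)
      (by norm_num) (by norm_num) le_card_cubesInBall_six (by decide +kernel)).trans_eq
      (by norm_num)
  · exact (cantorPowerMeasure_le_ofReal_div (num := 31501011683100224) (den := 10 ^ 15)
      (by norm_num) (by norm_num) le_card_cubesInBall_seven (by decide +kernel)).trans_eq
      (by norm_num)
  · exact (cantorPowerMeasure_le_ofReal_div (num := 6752795132236503) (den := 10 ^ 14)
      (by norm_num) (by norm_num) le_card_cubesInBall_eight (by decide +kernel)).trans_eq
      (by norm_num)
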